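/- Let $Q'$ be a fixed probability distribution on $\mathbb{R}$ that has mean zero and is sub-Gaussian, i.e. $\inf\{L>0 : \mathbb{E}_{\xi\sim Q'}[\exp(\xi^2/L^2)]\le 2\}<\infty$. Write $Q'(v)$ for the law of $\xi+v$ with $\xi\sim Q'$, and $\|\mu-\nu\|_{TV}=\sup_A|\mu(A)-\nu(A)|$ (supremum over measurable sets $A$) for the total variation distance. Assume that for some $\delta\in(0,1)$, $$\sup_{|v|<1}\|Q'(v)-Q'\|_{TV}<1-\delta .$$ Let $d=d_n\ge 1$ be integers with $d_n=o(\log n)$ and let $\sigma=\sigma_n>0$ be arbitrary noise levels. For each $n$, let $X_1,\dots,X_n$ be i.i.d. uniform on $[-1,1]^d$, let $\tilde Z_1,\dots,\tilde Z_n$ be i.i.d. random vectors in $\mathbb{R}^d$ with law $(Q')^{\otimes d}$, and let $\pi^\star$ be a uniformly random permutation of $\{1,\dots,n\}$, all independent, and put $$Y_i=X_{\pi^\star(i)}+\sigma\tilde Z_i,\qquad i=1,\dots,n.$$ An estimator $\hat\pi$ is a measurable map from $(X_1,\dots,X_n,Y_1,\dots,Y_n)$ to permutations of $\{1,\dots,n\}$.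 Then, as $n\to\infty$, $$\inf_{\hat\pi}\mathbb{E}\big[\#\{j : \hat\pi(j)\neq\pi^\star(j)\}\big]=\big(n^{2+o(1)}\sigma^d\big)\wedge n^{1+o(1)},$$ where the infimum is over all estimators; that is, there are real sequences $a_n\to0$ and $b_n\to0$ such that for all sufficiently large $n$ the left-hand side equals $\min\{n^{2+a_n}\sigma_n^{d_n},\,n^{1+b_n}\}$. -/

import Mathlib

open MeasureTheory ProbabilityTheory Filter Topology
open scoped ENNReal NNReal Asymptotics

noncomputable section

namespace GeoMatch

/-- `n` labelled points in `ℝ^d`. -/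
abbrev Points (n d : ℕ) : Type := Fin n → Fin d → ℝ

/-- The finite set `S_n` carries the discrete σ-algebra. -/
instance permMeasurableSpace (n : ℕ) : MeasurableSpace (Equiv.Perm (Fin n)) := ⊤

/-- The uniform distribution on the cube `[-1,1]^d`: normalized Lebesgue measure. -/
def unifCube (d : ℕ) : Measure (Fin d → ℝ) :=
  cond volume (Set.Icc (fun _ => (-1 : ℝ)) (fun _ => 1))

/-- The joint law of `((X, Z'), π)`: the points `X_1, …, X_n` are i.i.d. with law `P`, the
directions `Z'_1, …, Z'_n` are i.i.d. with law `Q`, the permutation `π` is uniform on `S_n`,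
and the three are independent. -/
def modelLaw (n d : ℕ) (P Q : Measure (Fin d → ℝ)) :
    Measure ((Points n d × Points n d) × Equiv.Perm (Fin n)) :=
  ((Measure.pi fun _ => P).prod (Measure.pi fun _ => Q)).prod (uniformOn Set.univ)

/-- The observed perturbed positions `Y_i = X_{π(i)} + σ Z'_i`. -/
def observed {n d : ℕ} (σ : ℝ) (X Z' : Points n d) (π : Equiv.Perm (Fin n)) : Points n d :=
  fun i => X (π i) + σ • Z' i

/-- An estimator: a measurable map from pairs `(X, Y)` of point sequences to permutations. -/
def Estimator (n d : ℕ) : Type :=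
  {f : Points n d × Points n d → Equiv.Perm (Fin n) // Measurable f}

/-- The expected number of mistakes `E[#{j : π̂(j) ≠ π(j)}]` of an estimator. -/
def expectedMistakes {n d : ℕ} (P Q : Measure (Fin d → ℝ)) (σ : ℝ) (f : Estimator n d) : ℝ :=
  ∫ ω, (hammingDist (f.1 (ω.1.1, observed σ ω.1.1 ω.1.2 ω.2) : Fin n → Fin n)
    (ω.2 : Fin n → Fin n) : ℝ) ∂(modelLaw n d P Q)

/-- The infimum over all estimators of the expected number of mistakes. -/
def minimaxMistakes (n d : ℕ) (P Q : Measure (Fin d → ℝ)) (σ : ℝ) : ℝ :=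
  ⨅ f : Estimator n d, expectedMistakes P Q σ f

/-- Total variation distance `sup_A |μ(A) - ν(A)|` over measurable `A`
(of two probability measures). -/
def tvDist {α : Type*} [MeasurableSpace α] (μ ν : Measure α) : ℝ :=
  ⨆ A : {A : Set α // MeasurableSet A}, |μ.real A.1 - ν.real A.1|

/-- `Q'(v)`: the law of `ξ + v` for `ξ` with law `Q'`. -/
def translate (Q' : Measure ℝ) (v : ℝ) : Measure ℝ := Q'.map (fun x => x + v)

/-- The sub-Gaussian norm of a law on `ℝ`: the infimum of all `L > 0` with
`E[exp(U² / L²)] ≤ 2`, infinite if there is none. -/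
def subGaussianNorm (Q' : Measure ℝ) : ℝ≥0∞ :=
  ⨅ (L : ℝ≥0) (_ : 0 < L ∧ ∫⁻ u, ENNReal.ofReal (Real.exp (u ^ 2 / (L : ℝ) ^ 2)) ∂Q' ≤ 2),
    (L : ℝ≥0∞)

end GeoMatch

end

/-! The minimax risk is squeezed between `min (n ^ 2 * σ ^ d) n` times `c₁ * A ^ d` and `c₂ * B ^
d`, with constants independent of `n` and `σ`. Since `d = o(log n)`, such factors are `n ^ o(1)`
(`exists_exponent_of_bounds`).

Upper bound. Estimate by a permutation with the fewest conflicts, a conflict being an index whose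
observation is at least as close to some other point as to its assigned one. A wrong index is a
conflict of the estimate or of the truth, so the risk is at most twice the expected number of
conflicts of the truth (`hammingDist_leastConflicts_le`). A Chernoff weight bounds the probability
that a given wrong point causes a conflict: integrating over that point gives a Gaussian integral of
order `σ ^ d`, and the sub-Gaussian moment controls the noise (`lintegral_conflictWeight_le`).
Summing over pairs gives `n ^ 2 * σ ^ d` up to an exponential factor in `d`; the bound `n` is
trivial.

Lower bound. Cut the cube into `K ^ d` cells of side at most `σ`. Exchanging the targets of two
points of one cell moves two rows of the observations, each coordinate by less than `σ`, so by the
total variation hypothesis the two laws share mass `δ ^ (2 * d)` and no estimator is right under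
both permutations (`le_miss_add_miss_swap`). Averaging over exchanges with a uniformly chosen cell
mate (`mul_card_le_two_mul_sum`) bounds the risk below by the probability of sharing a cell
(`le_measure_crowded`), which is of order `min 1 (n * σ ^ d)` up to an exponential factor in `d`. -/

namespace GeoMatch

/-! ### Product measures: monotonicity, Tonelli, common parts. -/

section ProductMeasures

variable {ι : Type*} [Fintype ι] {α : ι → Type*} [∀ i, MeasurableSpace (α i)]

/-- The product of measures is monotone in its factors. -/
theorem measure_pi_mono {μ ν : ∀ i, Measure (α i)} (h : ∀ i, μ i ≤ ν i) :
    Measure.pi μ ≤ Measure.pi ν := by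
  refine Measure.le_iff.2 fun s hs => ?_
  simp only [Measure.pi]
  rw [toMeasure_apply _ _ hs, toMeasure_apply _ _ hs]
  -- `OuterMeasure.pi` is the largest outer measure bounded by the product on boxes, so only boxes
  -- need checking and no finiteness is required.
  refine (OuterMeasure.le_pi.2 fun t _ => ?_ :
    OuterMeasure.pi (fun i => (μ i).toOuterMeasure) ≤
      OuterMeasure.pi (fun i => (ν i).toOuterMeasure)) s
  exact (OuterMeasure.pi_pi_le _ _).trans (Finset.prod_le_prod' fun i _ => h i (t i))

/-- Tonelli's theorem for a product of functions of one coordinate each. -/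
theorem lintegral_pi_prod [DecidableEq ι] (μ : ∀ i, Measure (α i)) [∀ i, SigmaFinite (μ i)]
    [∀ i, Nonempty (α i)] (f : ∀ i, α i → ℝ≥0∞) (hf : ∀ i, Measurable (f i)) :
    ∫⁻ x, ∏ i, f i (x i) ∂Measure.pi μ = ∏ i, ∫⁻ y, f i y ∂μ i := by
  have key : ∀ (s : Finset ι) (c : ℝ≥0∞) (x : ∀ i, α i),
      (∫⋯∫⁻_s, (fun x => c * ∏ i ∈ s, f i (x i)) ∂μ) x = c * ∏ i ∈ s, ∫⁻ y, f i y ∂μ i := by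
    intro s
    induction s using Finset.induction_on with
    | empty => intro c x; simp
    | insert i s hi ih =>
      intro c x
      rw [lmarginal_insert' _ (by fun_prop) hi]
      have : (fun x : ∀ i, α i => ∫⁻ y, c * ∏ j ∈ insert i s, f j (Function.update x i y j) ∂μ i)
          = fun x => (c * ∫⁻ y, f i y ∂μ i) * ∏ j ∈ s, f j (x j) := by
        ext x
        have h : ∀ y, c * ∏ j ∈ insert i s, f j (Function.update x i y j)
            = (c * ∏ j ∈ s, f j (x j)) * f i y := by
          intro y
          rw [Finset.prod_insert hi, Function.update_self,
            Finset.prod_congr rfl fun j hj => by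
              rw [Function.update_of_ne (ne_of_mem_of_not_mem hj hi)]]
          ring
        simp_rw [h]
        rw [lintegral_const_mul _ (hf i)]
        ring
      rw [this, ih, Finset.prod_insert hi]
      ring
  have x : ∀ i, α i := fun i => Classical.arbitrary _
  rw [lintegral_eq_lmarginal_univ x]
  simpa using key Finset.univ 1 x

/-- An integral over a product of probability measures is bounded by a bound for the integrals
over one of the coordinates. -/
theorem lintegral_pi_le_of_update [DecidableEq ι] (μ : ∀ i, Measure (α i))
    [∀ i, IsProbabilityMeasure (μ i)] {f : (∀ i, α i) → ℝ≥0∞} (hf : Measurable f) (j : ι)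
    {C : ℝ≥0∞} (hC : ∀ x, ∫⁻ y, f (Function.update x j y) ∂μ j ≤ C) :
    ∫⁻ x, f x ∂Measure.pi μ ≤ C := by
  have : ∀ i, Nonempty (α i) := fun i => (μ i).nonempty_of_neZero
  have x : ∀ i, α i := fun i => Classical.arbitrary _
  rw [lintegral_eq_lmarginal_univ x, lmarginal_erase' f hf (Finset.mem_univ j)]
  refine (lmarginal_mono (g := fun _ => C) hC x).trans ?_
  simp [lmarginal]

/-- If probability measures have a common part, so do their products; the mass of the common
part bounds the sum of the two error probabilities of any test. -/
theorem prod_mass_le_pi_add_pi_compl {μ ν ρ : ∀ i, Measure (α i)}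
    [∀ i, SigmaFinite (ρ i)] (hμ : ∀ i, ρ i ≤ μ i) (hν : ∀ i, ρ i ≤ ν i)
    (A : Set (∀ i, α i)) :
    ∏ i, ρ i Set.univ ≤ Measure.pi μ A + Measure.pi ν Aᶜ := by
  calc ∏ i, ρ i Set.univ = Measure.pi ρ Set.univ := by
        rw [← Measure.pi_pi, Set.pi_univ]
    _ ≤ Measure.pi ρ A + Measure.pi ρ Aᶜ := by
        rw [← Set.union_compl_self A]; exact measure_union_le _ _
    _ ≤ _ := add_le_add (measure_pi_mono hμ A) (measure_pi_mono hν Aᶜ)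

end ProductMeasures

/-! ### Overlap of the noise laws under small shifts. -/

/-- Two measures for which every test errs with total probability at least `η` have a common
part of mass at least `η`. -/
theorem le_inf_univ {α : Type*} [MeasurableSpace α] {μ ν : Measure α} {η : ℝ≥0∞}
    (h : ∀ A, MeasurableSet A → η ≤ μ A + ν Aᶜ) : η ≤ (μ ⊓ ν) Set.univ := by
  rw [Measure.inf_apply MeasurableSet.univ]
  refine le_sInf ?_
  rintro _ ⟨t, rfl⟩
  simp only [Set.inter_univ]
  -- The infimum ranges over arbitrary sets `t`. Passing to the measurable hull keeps the `μ`-mass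
  -- and can only shrink the complement.
  calc η ≤ μ (toMeasurable μ t) + ν (toMeasurable μ t)ᶜ := h _ (measurableSet_toMeasurable _ _)
    _ ≤ _ := by
      rw [measure_toMeasurable]
      gcongr
      exact subset_toMeasurable _ _

/-- The law of `x + σ ξ` for `ξ` with law `Q`. -/
noncomputable def shiftedLaw (Q : Measure ℝ) (σ x : ℝ) : Measure ℝ := Q.map fun z => x + σ * z

instance (Q : Measure ℝ) [IsProbabilityMeasure Q] (σ x : ℝ) :
    IsProbabilityMeasure (shiftedLaw Q σ x) :=
  Measure.isProbabilityMeasure_map (by fun_prop)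

theorem bddAbove_abs_measureReal_sub {α : Type*} [MeasurableSpace α] (μ ν : Measure α)
    [IsProbabilityMeasure μ] [IsProbabilityMeasure ν] :
    BddAbove (Set.range fun A : {A : Set α // MeasurableSet A} => |μ.real A.1 - ν.real A.1|) := by
  refine ⟨1, ?_⟩
  rintro _ ⟨A, rfl⟩
  have := measureReal_le_one (μ := μ) (s := A.1)
  have := measureReal_le_one (μ := ν) (s := A.1)
  have := measureReal_nonneg (μ := μ) (s := A.1)
  have := measureReal_nonneg (μ := ν) (s := A.1)
  exact abs_le.2 ⟨by linarith, by linarith⟩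

theorem tvDist_le_one {α : Type*} [MeasurableSpace α] (μ ν : Measure α)
    [IsProbabilityMeasure μ] [IsProbabilityMeasure ν] : tvDist μ ν ≤ 1 := by
  refine Real.iSup_le (fun A => ?_) zero_le_one
  have := measureReal_le_one (μ := μ) (s := A.1)
  have := measureReal_le_one (μ := ν) (s := A.1)
  have := measureReal_nonneg (μ := μ) (s := A.1)
  have := measureReal_nonneg (μ := ν) (s := A.1)
  exact abs_le.2 ⟨by linarith, by linarith⟩

instance (Q : Measure ℝ) [IsProbabilityMeasure Q] (v : ℝ) :
    IsProbabilityMeasure (translate Q v) :=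
  Measure.isProbabilityMeasure_map (by fun_prop)

/-- The two error probabilities sum to `1 - (Q A - translate Q v A)`, which is at least one minus
the total variation distance. -/
theorem le_translate_add_compl {Q : Measure ℝ} [IsProbabilityMeasure Q] {δ : ℝ}
    (hTV : (⨆ v : {v : ℝ // |v| < 1}, tvDist (translate Q v.1) Q) < 1 - δ) {v : ℝ}
    (hv : |v| < 1) {A : Set ℝ} (hA : MeasurableSet A) :
    ENNReal.ofReal δ ≤ translate Q v A + Q Aᶜ := by
  -- Real suprema bound their terms only when the range is bounded, hence the bounds by `1` here and
  -- in `h2`.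
  have hbdd : BddAbove (Set.range fun v : {v : ℝ // |v| < 1} => tvDist (translate Q v.1) Q) :=
    ⟨1, by rintro _ ⟨v, rfl⟩; exact tvDist_le_one _ _⟩
  have h1 : tvDist (translate Q v) Q < 1 - δ := (le_ciSup hbdd ⟨v, hv⟩).trans_lt hTV
  have h2 := (le_ciSup (bddAbove_abs_measureReal_sub (translate Q v) Q) ⟨A, hA⟩).trans_lt h1
  have h3 := (abs_lt.1 h2).1
  rw [← ofReal_measureReal (μ := translate Q v), ← ofReal_measureReal (μ := Q),
    ← ENNReal.ofReal_add measureReal_nonneg measureReal_nonneg]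
  refine ENNReal.ofReal_le_ofReal ?_
  rw [probReal_compl_eq_one_sub hA]
  simp only at h3
  linarith

/-- The map `z ↦ y + σ * z` carries `Q` and its translate by `(x - y) / σ` to the two shifted laws,
so a test between the latter pulls back to a test between the former. -/
theorem le_shiftedLaw_inf {Q : Measure ℝ} [IsProbabilityMeasure Q] {δ : ℝ}
    (hTV : (⨆ v : {v : ℝ // |v| < 1}, tvDist (translate Q v.1) Q) < 1 - δ) {σ : ℝ} (hσ : 0 < σ)
    {x y : ℝ} (h : |x - y| < σ) :
    ENNReal.ofReal δ ≤ (shiftedLaw Q σ x ⊓ shiftedLaw Q σ y) Set.univ := by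
  refine le_inf_univ fun A hA => ?_
  have hv : |(x - y) / σ| < 1 := by rwa [abs_div, abs_of_pos hσ, div_lt_one hσ]
  have hm : Measurable fun z => y + σ * z := by fun_prop
  refine (le_translate_add_compl hTV hv (hm hA)).trans (le_of_eq ?_)
  rw [shiftedLaw, shiftedLaw, translate, Measure.map_apply (by fun_prop) (hm hA),
    Measure.map_apply (by fun_prop) hA, Measure.map_apply (by fun_prop) hA.compl]
  congr 2
  ext z
  simp only [Set.mem_preimage]
  rw [mul_add, mul_div_cancel₀ _ hσ.ne']
  ring_nf

/-- The law of the observations given the points (in the order in which they are observed). -/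
noncomputable def observationLaw (Q : Measure ℝ) (σ : ℝ) {n d : ℕ} (X : Points n d) :
    Measure (Points n d) :=
  Measure.pi fun i => Measure.pi fun k => shiftedLaw Q σ (X i k)

/-- Given the points, the rows of the noise are i.i.d., so the permutation only reorders the points.
Comparing two permutations thus becomes comparing two configurations. -/
theorem map_observed (Q : Measure ℝ) [IsProbabilityMeasure Q] (σ : ℝ) {n d : ℕ}
    (X : Points n d) (π : Equiv.Perm (Fin n)) :
    (Measure.pi fun _ => Measure.pi fun _ => Q).map (fun Z => observed σ X Z π)
      = observationLaw Q σ (fun i => X (π i)) := by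
  have hrow : ∀ x : Fin d → ℝ, (Measure.pi fun _ : Fin d => Q).map (fun z => x + σ • z)
      = Measure.pi fun k => shiftedLaw Q σ (x k) := fun x =>
    Measure.pi_map_pi (μ := fun _ : Fin d => Q) (f := fun k z => x k + σ * z)
      (hμ := fun k => inferInstanceAs (SigmaFinite (shiftedLaw Q σ (x k))))
      (fun k => by fun_prop)
  unfold observationLaw
  simp_rw [← hrow]
  have hp : ∀ i, IsProbabilityMeasure
      ((Measure.pi fun _ : Fin d => Q).map (fun z => X (π i) + σ • z)) := fun i =>
    Measure.isProbabilityMeasure_map (by fun_prop)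
  exact Measure.pi_map_pi (μ := fun _ : Fin n => Measure.pi fun _ : Fin d => Q)
    (f := fun i z => X (π i) + σ • z) (hμ := fun i => inferInstance) (fun i => by fun_prop)

/-- The observations do not separate two configurations of points that differ in two places
only, by less than the noise level in each coordinate. -/
theorem le_observationLaw_add_compl {Q : Measure ℝ} [IsProbabilityMeasure Q] {δ : ℝ}
    (hTV : (⨆ v : {v : ℝ // |v| < 1}, tvDist (translate Q v.1) Q) < 1 - δ) {σ : ℝ} (hσ : 0 < σ)
    {n d : ℕ} {X X' : Points n d} {i j : Fin n} (hij : i ≠ j)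
    (hne : ∀ m, m ≠ i → m ≠ j → X m = X' m) (hi : ∀ k, |X i k - X' i k| < σ)
    (hj : ∀ k, |X j k - X' j k| < σ) (A : Set (Points n d)) :
    ENNReal.ofReal δ ^ (2 * d) ≤ observationLaw Q σ X A + observationLaw Q σ X' Aᶜ := by
  set ρ : Fin n → Measure (Fin d → ℝ) := fun m =>
    Measure.pi fun k => shiftedLaw Q σ (X m k) ⊓ shiftedLaw Q σ (X' m k)
  have hfin : ∀ m k, IsFiniteMeasure (shiftedLaw Q σ (X m k) ⊓ shiftedLaw Q σ (X' m k)) :=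
    fun m k => isFiniteMeasure_of_le _ (inf_le_left)
  have hmass : ∀ m, ρ m Set.univ
      = ∏ k, (shiftedLaw Q σ (X m k) ⊓ shiftedLaw Q σ (X' m k)) Set.univ := by
    intro m
    rw [← Measure.pi_pi, Set.pi_univ]
  have hclose : ∀ m, (∀ k, |X m k - X' m k| < σ) → ENNReal.ofReal δ ^ d ≤ ρ m Set.univ := by
    intro m hm
    rw [hmass]
    simpa using Finset.prod_le_prod' (s := (Finset.univ : Finset (Fin d))) fun k _ =>
      le_shiftedLaw_inf hTV hσ (hm k)
  have hother : ∀ m, m ∉ ({i, j} : Finset (Fin n)) → ρ m Set.univ = 1 := by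
    intro m hm
    simp only [Finset.mem_insert, Finset.mem_singleton, not_or] at hm
    rw [hmass, hne m hm.1 hm.2]
    simp
  have := prod_mass_le_pi_add_pi_compl (ρ := ρ)
    (μ := fun i => Measure.pi fun k => shiftedLaw Q σ (X i k))
    (ν := fun i => Measure.pi fun k => shiftedLaw Q σ (X' i k))
    (fun m => measure_pi_mono fun k => inf_le_left)
    (fun m => measure_pi_mono fun k => inf_le_right) A
  refine le_trans ?_ this
  -- Unchanged rows have full common mass `1`; the two moved rows contribute `δ ^ d` each.
  rw [← Finset.prod_subset (Finset.subset_univ {i, j}) fun m _ hm => hother m hm,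
    Finset.prod_pair hij, two_mul, pow_add]
  exact mul_le_mul' (hclose i hi) (hclose j hj)

end GeoMatch

/-! ### The model law: measurability and integration. -/

namespace GeoMatch

instance (n : ℕ) : DiscreteMeasurableSpace (Equiv.Perm (Fin n)) := ⟨fun _ => trivial⟩

theorem measurable_observed {n d : ℕ} (σ : ℝ) :
    Measurable fun ω : (Points n d × Points n d) × Equiv.Perm (Fin n) =>
      observed σ ω.1.1 ω.1.2 ω.2 := by
  have key : ∀ π : Equiv.Perm (Fin n),
      Measurable fun p : Points n d × Points n d => observed σ p.1 p.2 π := by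
    intro π
    refine measurable_pi_lambda _ fun i => ?_
    have : Measurable fun p : Points n d × Points n d => p.1 (π i) + σ • p.2 i := by fun_prop
    exact this
  exact measurable_from_prod_countable_left key

theorem measurable_hammingDist_estimator {n d : ℕ} (σ : ℝ) (f : Estimator n d) :
    Measurable fun ω : (Points n d × Points n d) × Equiv.Perm (Fin n) =>
      hammingDist (f.1 (ω.1.1, observed σ ω.1.1 ω.1.2 ω.2) : Fin n → Fin n)
        (ω.2 : Fin n → Fin n) := by
  have h1 : Measurable fun ω : (Points n d × Points n d) × Equiv.Perm (Fin n) =>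
      (f.1 (ω.1.1, observed σ ω.1.1 ω.1.2 ω.2), ω.2) :=
    (f.2.comp ((measurable_fst.comp measurable_fst).prodMk (measurable_observed σ))).prodMk
      measurable_snd
  exact (Measurable.of_discrete (f := fun p : Equiv.Perm (Fin n) × Equiv.Perm (Fin n) =>
    hammingDist (p.1 : Fin n → Fin n) (p.2 : Fin n → Fin n))).comp h1

theorem expectedMistakes_nonneg {n d : ℕ} (P Q : Measure (Fin d → ℝ)) (σ : ℝ)
    (f : Estimator n d) : 0 ≤ expectedMistakes P Q σ f :=
  integral_nonneg fun _ => Nat.cast_nonneg _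

theorem minimaxMistakes_le_expectedMistakes {n d : ℕ} (P Q : Measure (Fin d → ℝ)) (σ : ℝ)
    (f : Estimator n d) : minimaxMistakes n d P Q σ ≤ expectedMistakes P Q σ f :=
  ciInf_le ⟨0, by rintro _ ⟨f, rfl⟩; exact expectedMistakes_nonneg P Q σ f⟩ f

instance (n d : ℕ) : Nonempty (Estimator n d) := ⟨⟨fun _ => 1, measurable_const⟩⟩

theorem measurable_natCast_hammingDist_estimator {n d : ℕ} (σ : ℝ) (f : Estimator n d) :
    Measurable fun ω : (Points n d × Points n d) × Equiv.Perm (Fin n) =>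
      (hammingDist (f.1 (ω.1.1, observed σ ω.1.1 ω.1.2 ω.2) : Fin n → Fin n)
        (ω.2 : Fin n → Fin n) : ℝ≥0∞) :=
  (Measurable.of_discrete (f := fun k : ℕ => (k : ℝ≥0∞))).comp
    (measurable_hammingDist_estimator σ f)

section Model

variable {n d : ℕ} (P Q : Measure (Fin d → ℝ)) [IsProbabilityMeasure P] [IsProbabilityMeasure Q]

instance : IsProbabilityMeasure (modelLaw n d P Q) := by
  unfold modelLaw; infer_instance

theorem lintegral_modelLaw {F : (Points n d × Points n d) × Equiv.Perm (Fin n) → ℝ≥0∞}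
    (hF : Measurable F) :
    ∫⁻ ω, F ω ∂modelLaw n d P Q = (n.factorial : ℝ≥0∞)⁻¹ * ∑ π : Equiv.Perm (Fin n),
      ∫⁻ X, ∫⁻ Z, F ((X, Z), π) ∂(Measure.pi fun _ => Q) ∂(Measure.pi fun _ => P) := by
  unfold modelLaw
  rw [lintegral_prod_symm _ hF.aemeasurable, lintegral_fintype, Finset.mul_sum]
  refine Finset.sum_congr rfl fun π _ => ?_
  rw [lintegral_prod _ (by fun_prop), mul_comm, uniformOn_univ, Measure.count_singleton,
    Fintype.card_perm, Fintype.card_fin, one_div]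

theorem lintegral_modelLaw_le {F : (Points n d × Points n d) × Equiv.Perm (Fin n) → ℝ≥0∞}
    (hF : Measurable F) {C : ℝ≥0∞}
    (hC : ∀ π, ∫⁻ X, ∫⁻ Z, F ((X, Z), π) ∂(Measure.pi fun _ => Q) ∂(Measure.pi fun _ => P) ≤ C) :
    ∫⁻ ω, F ω ∂modelLaw n d P Q ≤ C := by
  rw [lintegral_modelLaw P Q hF]
  refine (mul_le_mul_right (Finset.sum_le_sum fun π _ => hC π) _).trans ?_
  rw [Finset.sum_const, Finset.card_univ, Fintype.card_perm, Fintype.card_fin, nsmul_eq_mul,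
    ← mul_assoc, ENNReal.inv_mul_cancel (by exact_mod_cast n.factorial_ne_zero)
      (ENNReal.natCast_ne_top _), one_mul]

theorem ofReal_expectedMistakes (σ : ℝ) (f : Estimator n d) :
    ENNReal.ofReal (expectedMistakes P Q σ f) =
      ∫⁻ ω, (hammingDist (f.1 (ω.1.1, observed σ ω.1.1 ω.1.2 ω.2) : Fin n → Fin n)
        (ω.2 : Fin n → Fin n) : ℝ≥0∞) ∂modelLaw n d P Q := by
  unfold expectedMistakes
  have hm : Measurable fun ω : (Points n d × Points n d) × Equiv.Perm (Fin n) =>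
      (hammingDist (f.1 (ω.1.1, observed σ ω.1.1 ω.1.2 ω.2) : Fin n → Fin n)
        (ω.2 : Fin n → Fin n) : ℝ) :=
    (Measurable.of_discrete (f := fun k : ℕ => (k : ℝ))).comp
      (measurable_hammingDist_estimator σ f)
  rw [ofReal_integral_eq_lintegral_ofReal]
  · simp
  · refine Integrable.of_bound hm.aestronglyMeasurable (n : ℝ) (ae_of_all _ fun ω => ?_)
    rw [Real.norm_natCast]
    exact_mod_cast (hammingDist_le_card_fintype).trans_eq (Fintype.card_fin n)
  · exact ae_of_all _ fun ω => Nat.cast_nonneg _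

theorem minimaxMistakes_le_card (σ : ℝ) : minimaxMistakes n d P Q σ ≤ n := by
  refine (minimaxMistakes_le_expectedMistakes P Q σ (Classical.arbitrary _)).trans ?_
  refine (ENNReal.ofReal_le_ofReal_iff (Nat.cast_nonneg n)).1 ?_
  rw [ofReal_expectedMistakes, ENNReal.ofReal_natCast]
  refine (lintegral_mono (g := fun _ => (n : ℝ≥0∞)) fun ω => ?_).trans (by simp)
  exact Nat.cast_le.2 ((hammingDist_le_card_fintype).trans_eq (Fintype.card_fin n))

end Model

/-! ### Upper bound: the permutation with fewest conflicts. -/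

/-- The squared Euclidean distance. -/
def sqDist {d : ℕ} (x y : Fin d → ℝ) : ℝ := ∑ k, (x k - y k) ^ 2

@[fun_prop]
theorem measurable_sqDist {d : ℕ} {β : Type*} [MeasurableSpace β] {f g : β → Fin d → ℝ}
    (hf : Measurable f) (hg : Measurable g) : Measurable fun b => sqDist (f b) (g b) := by
  unfold sqDist
  fun_prop

open Classical in
/-- The indices that `π` does not match to their strictly closest point, where `D i j j'` says
that `j` is at least as close to `i` as `j'`. -/
noncomputable def conflicts {n : ℕ} (D : Fin n → Fin n → Fin n → Prop) (π : Equiv.Perm (Fin n)) :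
    Finset (Fin n) :=
  Finset.univ.filter fun i => ∃ j, j ≠ π i ∧ D i j (π i)

/-- A permutation with as few conflicts as possible. -/
noncomputable def leastConflicts {n : ℕ} (D : Fin n → Fin n → Fin n → Prop) :
    Equiv.Perm (Fin n) :=
  (Finite.exists_min fun π : Equiv.Perm (Fin n) => (conflicts D π).card).choose

theorem card_conflicts_leastConflicts_le {n : ℕ} (D : Fin n → Fin n → Fin n → Prop)
    (π : Equiv.Perm (Fin n)) :
    (conflicts D (leastConflicts D)).card ≤ (conflicts D π).card :=
  (Finite.exists_min fun π : Equiv.Perm (Fin n) => (conflicts D π).card).choose_spec π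

/-- Where the two permutations disagree, totality of `D` makes one of the two targets at least as
close as the other, so the index is a conflict of one of them. Minimality bounds the union by twice
the conflicts of `π`. -/
theorem hammingDist_leastConflicts_le {n : ℕ} {D : Fin n → Fin n → Fin n → Prop}
    (hD : ∀ i j j', D i j j' ∨ D i j' j) (π : Equiv.Perm (Fin n)) :
    hammingDist (leastConflicts D : Fin n → Fin n) (π : Fin n → Fin n)
      ≤ 2 * (conflicts D π).card := by
  have hsub : (Finset.univ.filter fun i => leastConflicts D i ≠ π i) ⊆
      conflicts D (leastConflicts D) ∪ conflicts D π := by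
    intro i hi
    simp only [Finset.mem_filter, Finset.mem_univ, true_and, Finset.mem_union, conflicts] at hi ⊢
    rcases hD i (π i) (leastConflicts D i) with h | h
    · exact Or.inl ⟨_, hi.symm, h⟩
    · exact Or.inr ⟨_, hi, h⟩
  have h1 : hammingDist (leastConflicts D : Fin n → Fin n) (π : Fin n → Fin n) ≤
      (conflicts D (leastConflicts D) ∪ conflicts D π).card := Finset.card_le_card hsub
  have h2 := Finset.card_union_le (conflicts D (leastConflicts D)) (conflicts D π)
  have h3 := card_conflicts_leastConflicts_le D π
  omega

/-- The estimator that minimizes the number of conflicts. -/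
noncomputable def nearestEstimator (n d : ℕ) : Estimator n d :=
  ⟨fun p => leastConflicts fun i j j' => sqDist (p.2 i) (p.1 j) ≤ sqDist (p.2 i) (p.1 j'), by
    -- The estimate depends on the data only through the finite table of comparisons, a discrete
    -- space.
    refine (Measurable.of_discrete (f := fun D : Fin n → Fin n → Fin n → Prop =>
      leastConflicts D)).comp ?_
    refine measurable_pi_lambda _ fun i => measurable_pi_lambda _ fun j =>
      measurable_pi_lambda _ fun j' => ?_
    exact measurableSet_setOfPred.1 (measurableSet_le (by fun_prop) (by fun_prop))⟩

/-! ### Upper bound: Gaussian integrals and the Chernoff estimate. -/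

instance (d : ℕ) : IsProbabilityMeasure (unifCube d) := by
  refine cond_isProbabilityMeasure_of_finite ?_ ?_
  · rw [Real.volume_Icc_pi]; norm_num
  · rw [Real.volume_Icc_pi]; exact ENNReal.prod_ne_top fun _ _ => ENNReal.ofReal_ne_top

theorem unifCube_apply {d : ℕ} (s : Set (Fin d → ℝ)) :
    unifCube d s = (2 ^ d)⁻¹ * volume (Set.Icc (fun _ => (-1 : ℝ)) (fun _ => 1) ∩ s) := by
  rw [unifCube, cond_apply measurableSet_Icc, Real.volume_Icc_pi]
  norm_num

theorem lintegral_unifCube_le {d : ℕ} (F : (Fin d → ℝ) → ℝ≥0∞) :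
    ∫⁻ x, F x ∂unifCube d ≤ (2 ^ d)⁻¹ * ∫⁻ x, F x := by
  rw [unifCube, ProbabilityTheory.cond, lintegral_smul_measure, Real.volume_Icc_pi]
  norm_num
  gcongr
  exact Measure.restrict_le_self

theorem lintegral_gaussian {s : ℝ} (hs : 0 < s) (y : ℝ) :
    ∫⁻ x, ENNReal.ofReal (Real.exp (-((y - x) ^ 2 / s ^ 2)))
      = ENNReal.ofReal (s * √Real.pi) := by
  have h0 : ∀ x, Real.exp (-((y - x) ^ 2 / s ^ 2)) = Real.exp (-(s ^ 2)⁻¹ * (x - y) ^ 2) := by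
    intro x
    congr 1
    ring
  simp_rw [h0]
  have hb : 0 < (s ^ 2)⁻¹ := by positivity
  rw [lintegral_sub_right_eq_self (fun x => ENNReal.ofReal (Real.exp (-(s ^ 2)⁻¹ * x ^ 2))) y,
    ← ofReal_integral_eq_lintegral_ofReal (integrable_exp_neg_mul_sq hb)
      (ae_of_all _ fun _ => (Real.exp_pos _).le), integral_gaussian, div_inv_eq_mul, mul_comm,
    Real.sqrt_mul (by positivity), Real.sqrt_sq hs.le]

theorem ofReal_exp_sum {ι : Type*} [Fintype ι] (f : ι → ℝ) :
    ENNReal.ofReal (Real.exp (∑ k, f k)) = ∏ k, ENNReal.ofReal (Real.exp (f k)) := by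
  rw [Real.exp_sum, ENNReal.ofReal_prod_of_nonneg fun _ _ => (Real.exp_pos _).le]

/-- Dropping the restriction to the cube leaves a translation-invariant Gaussian integral. The
uniformity in `y` lets it be used at an observation depending on the other points and the noise. -/
theorem lintegral_unifCube_exp_sqDist_le {d : ℕ} {s : ℝ} (hs : 0 < s) (y : Fin d → ℝ) :
    ∫⁻ x, ENNReal.ofReal (Real.exp (-(sqDist y x / s ^ 2))) ∂unifCube d
      ≤ (2 ^ d)⁻¹ * ENNReal.ofReal (s * √Real.pi) ^ d := by
  refine (lintegral_unifCube_le _).trans ?_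
  gcongr
  simp_rw [sqDist, Finset.sum_div, ← Finset.sum_neg_distrib, ofReal_exp_sum]
  rw [volume_pi, lintegral_pi_prod (fun _ : Fin d => (volume : Measure ℝ))
    (fun k x => ENNReal.ofReal (Real.exp (-((y k - x) ^ 2 / s ^ 2)))) (fun k => by fun_prop)]
  simp [lintegral_gaussian hs]

theorem lintegral_exp_sq_le {Q : Measure ℝ} [IsProbabilityMeasure Q] {L : ℝ}
    (hL : ∫⁻ u, ENNReal.ofReal (Real.exp (u ^ 2 / L ^ 2)) ∂Q ≤ 2) (d : ℕ) :
    ∫⁻ z, ENNReal.ofReal (Real.exp (∑ k, z k ^ 2 / L ^ 2)) ∂(Measure.pi fun _ : Fin d => Q)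
      ≤ 2 ^ d := by
  simp_rw [ofReal_exp_sum]
  rw [lintegral_pi_prod (fun _ : Fin d => Q)
    (fun k x => ENNReal.ofReal (Real.exp (x ^ 2 / L ^ 2))) (fun k => by fun_prop)]
  simpa using Finset.prod_le_prod' (s := (Finset.univ : Finset (Fin d))) fun _ _ => hL

/-- The exponential weight that dominates the event that the observation `X a + σ Z i` is at
least as close to the `j`-th point as to its own point `X a`. -/
noncomputable def conflictWeight {n d : ℕ} (σ s : ℝ) (i a j : Fin n) (X Z : Points n d) : ℝ≥0∞ :=
  ENNReal.ofReal (Real.exp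
    ((sqDist (X a + σ • Z i) (X a) - sqDist (X a + σ • Z i) (X j)) / s ^ 2))

theorem measurable_conflictWeight {n d : ℕ} (σ s : ℝ) (i a j : Fin n) :
    Measurable fun p : Points n d × Points n d => conflictWeight σ s i a j p.1 p.2 := by
  unfold conflictWeight
  fun_prop

/-- At scale `s = σ * L` the weight splits: the distance to the true point is the noise alone and
contributes at most `2 ^ d` by the sub-Gaussian moment, while integrating over `X j` with all else
fixed contributes the Gaussian integral divided by `2 ^ d`, the volume of the cube. The two powers
of `2` cancel. -/
theorem lintegral_conflictWeight_le {Q : Measure ℝ} [IsProbabilityMeasure Q] {L : ℝ}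
    (hL0 : 0 < L) (hL : ∫⁻ u, ENNReal.ofReal (Real.exp (u ^ 2 / L ^ 2)) ∂Q ≤ 2) {σ : ℝ}
    (hσ : 0 < σ) {n d : ℕ} (i a j : Fin n) (haj : j ≠ a) :
    ∫⁻ X : Points n d, ∫⁻ Z : Points n d, conflictWeight σ (σ * L) i a j X Z
      ∂(Measure.pi fun _ => Measure.pi fun _ => Q) ∂(Measure.pi fun _ => unifCube d)
      ≤ ENNReal.ofReal (σ * L * √Real.pi) ^ d := by
  rw [lintegral_lintegral_swap (measurable_conflictWeight σ (σ * L) i a j).aemeasurable]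
  unfold conflictWeight
  have hs : 0 < σ * L := by positivity
  have hinner : ∀ Z : Points n d, ∫⁻ X : Points n d,
      ENNReal.ofReal (Real.exp ((sqDist (X a + σ • Z i) (X a) - sqDist (X a + σ • Z i) (X j))
        / (σ * L) ^ 2)) ∂(Measure.pi fun _ => unifCube d)
      ≤ ENNReal.ofReal (Real.exp (∑ k, Z i k ^ 2 / L ^ 2)) *
        ((2 ^ d)⁻¹ * ENNReal.ofReal (σ * L * √Real.pi) ^ d) := by
    intro Z
    refine lintegral_pi_le_of_update (fun _ : Fin n => unifCube d) (by fun_prop) j fun X => ?_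
    have hsplit : ∀ y : Fin d → ℝ, ENNReal.ofReal (Real.exp
        ((sqDist (Function.update X j y a + σ • Z i) (Function.update X j y a)
          - sqDist (Function.update X j y a + σ • Z i) (Function.update X j y j)) / (σ * L) ^ 2))
        = ENNReal.ofReal (Real.exp (∑ k, Z i k ^ 2 / L ^ 2)) *
          ENNReal.ofReal (Real.exp (-(sqDist (X a + σ • Z i) y / (σ * L) ^ 2))) := by
      intro y
      rw [Function.update_self, Function.update_of_ne haj.symm,
        ← ENNReal.ofReal_mul (Real.exp_pos _).le, ← Real.exp_add, sub_div, sub_eq_add_neg]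
      congr 4
      rw [sqDist, Finset.sum_div]
      refine Finset.sum_congr rfl fun k _ => ?_
      simp only [Pi.add_apply, Pi.smul_apply, smul_eq_mul, add_sub_cancel_left]
      rw [mul_pow, mul_pow, mul_div_mul_left _ _ (by positivity)]
    simp_rw [hsplit]
    rw [lintegral_const_mul _ (by fun_prop)]
    gcongr
    exact lintegral_unifCube_exp_sqDist_le hs _
  refine (lintegral_mono hinner).trans ?_
  rw [lintegral_mul_const _ (by fun_prop)]
  have heval : ∫⁻ Z : Points n d, ENNReal.ofReal (Real.exp (∑ k, Z i k ^ 2 / L ^ 2))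
      ∂(Measure.pi fun _ => Measure.pi fun _ => Q)
      = ∫⁻ z, ENNReal.ofReal (Real.exp (∑ k, z k ^ 2 / L ^ 2))
        ∂(Measure.pi fun _ : Fin d => Q) :=
    (measurePreserving_eval (fun _ : Fin n => Measure.pi fun _ : Fin d => Q) i).lintegral_comp
      (f := fun z => ENNReal.ofReal (Real.exp (∑ k, z k ^ 2 / L ^ 2))) (by fun_prop)
  rw [heval]
  refine (mul_le_mul_left (lintegral_exp_sq_le hL d) _).trans ?_
  rw [← mul_assoc, ENNReal.mul_inv_cancel (by simp) (by simp), one_mul]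

/-- A conflict with `j` makes the exponent nonnegative and the weight at least `1`; the rest is a
union bound. -/
theorem card_conflicts_le {n d : ℕ} {σ s : ℝ} (X Z : Points n d) (π : Equiv.Perm (Fin n)) :
    ((conflicts (fun i j j' => sqDist (observed σ X Z π i) (X j)
      ≤ sqDist (observed σ X Z π i) (X j')) π).card : ℝ≥0∞) ≤
    ∑ i, ∑ j ∈ Finset.univ.erase (π i), conflictWeight σ s i (π i) j X Z := by
  classical
  rw [conflicts, Finset.card_filter, Nat.cast_sum]
  refine Finset.sum_le_sum fun i _ => ?_
  split_ifs with h
  · obtain ⟨j, hj, hle⟩ := h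
    refine le_trans ?_ (Finset.single_le_sum (fun _ _ => zero_le)
      (Finset.mem_erase.2 ⟨hj, Finset.mem_univ j⟩))
    rw [conflictWeight, Nat.cast_one, ENNReal.one_le_ofReal, Real.one_le_exp_iff]
    exact div_nonneg (sub_nonneg.2 hle) (sq_nonneg s)
  · simp

theorem lintegral_lintegral_finset_sum {α β ι : Type*} [MeasurableSpace α] [MeasurableSpace β]
    {μ : Measure α} {ν : Measure β} [SFinite ν] (s : Finset ι) {F : ι → α → β → ℝ≥0∞}
    (hF : ∀ i ∈ s, Measurable fun p : α × β => F i p.1 p.2) :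
    ∫⁻ x, ∫⁻ y, ∑ i ∈ s, F i x y ∂ν ∂μ = ∑ i ∈ s, ∫⁻ x, ∫⁻ y, F i x y ∂ν ∂μ := by
  have h : ∀ x, ∫⁻ y, ∑ i ∈ s, F i x y ∂ν = ∑ i ∈ s, ∫⁻ y, F i x y ∂ν := fun x =>
    lintegral_finsetSum' s fun i hi => ((hF i hi).comp measurable_prodMk_left).aemeasurable
  simp_rw [h]
  exact lintegral_finsetSum' s fun i hi => (hF i hi).lintegral_prod_right'.aemeasurable

theorem lintegral_lintegral_const_mul {α β : Type*} [MeasurableSpace α] [MeasurableSpace β]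
    {μ : Measure α} {ν : Measure β} {c : ℝ≥0∞} (hc : c ≠ ∞) (F : α → β → ℝ≥0∞) :
    ∫⁻ x, ∫⁻ y, c * F x y ∂ν ∂μ = c * ∫⁻ x, ∫⁻ y, F x y ∂ν ∂μ := by
  simp_rw [lintegral_const_mul' _ _ hc]

theorem hammingDist_nearestEstimator_le {n d : ℕ} {σ s : ℝ} (X Z : Points n d)
    (π : Equiv.Perm (Fin n)) :
    (hammingDist ((nearestEstimator n d).1 (X, observed σ X Z π) : Fin n → Fin n)
      (π : Fin n → Fin n) : ℝ≥0∞) ≤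
    2 * ∑ i, ∑ j ∈ Finset.univ.erase (π i), conflictWeight σ s i (π i) j X Z := by
  refine le_trans ?_ (mul_le_mul_right (card_conflicts_le X Z π) 2)
  have := hammingDist_leastConflicts_le (D := fun i j j' =>
    sqDist (observed σ X Z π i) (X j) ≤ sqDist (observed σ X Z π i) (X j'))
    (fun i j j' => le_total _ _) π
  refine (Nat.cast_le (α := ℝ≥0∞).2 this).trans ?_
  rw [Nat.cast_mul, Nat.cast_ofNat]

/-- The factor `2` is the price of minimizing conflicts, and `n ^ 2` bounds the number of pairs of
an index and a wrong target. -/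
theorem minimaxMistakes_le {Q : Measure ℝ} [IsProbabilityMeasure Q] {L : ℝ} (hL0 : 0 < L)
    (hL : ∫⁻ u, ENNReal.ofReal (Real.exp (u ^ 2 / L ^ 2)) ∂Q ≤ 2) {σ : ℝ} (hσ : 0 < σ)
    (n d : ℕ) :
    minimaxMistakes n d (unifCube d) (Measure.pi fun _ => Q) σ
      ≤ 2 * n ^ 2 * (σ * L * √Real.pi) ^ d := by
  refine (minimaxMistakes_le_expectedMistakes _ _ σ (nearestEstimator n d)).trans ?_
  refine (ENNReal.ofReal_le_ofReal_iff (by positivity)).1 ?_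
  rw [ofReal_expectedMistakes]
  refine lintegral_modelLaw_le _ _ (measurable_natCast_hammingDist_estimator σ _) fun π => ?_
  refine (lintegral_mono fun X => lintegral_mono fun Z =>
    hammingDist_nearestEstimator_le (s := σ * L) X Z π).trans ?_
  rw [lintegral_lintegral_const_mul (by simp), lintegral_lintegral_finset_sum _ fun i _ =>
    Finset.measurable_sum _ fun j _ => measurable_conflictWeight σ (σ * L) i (π i) j]
  have hrow : ∀ i, ∫⁻ X : Points n d, ∫⁻ Z : Points n d,
      ∑ j ∈ Finset.univ.erase (π i), conflictWeight σ (σ * L) i (π i) j X Z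
        ∂(Measure.pi fun _ => Measure.pi fun _ => Q) ∂(Measure.pi fun _ => unifCube d)
      ≤ ∑ _j : Fin n, ENNReal.ofReal (σ * L * √Real.pi) ^ d := by
    intro i
    rw [lintegral_lintegral_finset_sum _ fun j _ =>
      measurable_conflictWeight σ (σ * L) i (π i) j]
    refine (Finset.sum_le_sum fun j hj => lintegral_conflictWeight_le hL0 hL hσ i (π i) j
      (Finset.ne_of_mem_erase hj)).trans ?_
    exact Finset.sum_le_sum_of_subset (Finset.erase_subset _ _)
  refine (mul_le_mul_right (Finset.sum_le_sum fun i _ => hrow i) 2).trans_eq ?_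
  rw [ENNReal.ofReal_mul (p := 2 * (n : ℝ) ^ 2) (by positivity),
    ENNReal.ofReal_mul (p := 2) (by positivity),
    ENNReal.ofReal_pow (by positivity), ENNReal.ofReal_pow (by positivity)]
  simp only [Finset.sum_const, Finset.card_univ, Fintype.card_fin, nsmul_eq_mul,
    ENNReal.ofReal_natCast, ENNReal.ofReal_ofNat]
  ring

end GeoMatch

namespace GeoMatch

/-! ### Lower bound: averaging over exchanges of targets. -/

section Swapping

variable {n : ℕ} {r : Fin n → Fin n → Prop}

open Classical in
/-- The points other than `a` that are related to `a`. -/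
noncomputable def mates (r : Fin n → Fin n → Prop) (a : Fin n) : Finset (Fin n) :=
  (Finset.univ.filter (r a)).erase a

theorem mem_mates {a b : Fin n} : b ∈ mates r a ↔ b ≠ a ∧ r a b := by
  simp [mates]

theorem mem_mates_comm (hs : ∀ a b, r a b → r b a) {a b : Fin n} :
    b ∈ mates r a ↔ a ∈ mates r b := by
  rw [mem_mates, mem_mates]
  exact ⟨fun h => ⟨h.1.symm, hs _ _ h.2⟩, fun h => ⟨h.1.symm, hs _ _ h.2⟩⟩

theorem card_mates_eq (hs : ∀ a b, r a b → r b a) (ht : ∀ a b c, r a b → r b c → r a c)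
    {a b : Fin n} (h : r a b) : (mates r a).card = (mates r b).card := by
  classical
  have hba := hs _ _ h
  have heq : Finset.univ.filter (r a) = Finset.univ.filter (r b) := by
    ext c
    simp only [Finset.mem_filter, Finset.mem_univ, true_and]
    exact ⟨ht _ _ _ hba, ht _ _ _ h⟩
  unfold mates
  -- Reflexivity is not assumed: `r a a` and `r b b` follow from `h` and its reverse.
  rw [Finset.card_erase_of_mem (by simpa using ht _ _ _ h hba),
    Finset.card_erase_of_mem (by simpa using ht _ _ _ hba h), heq]

open Classical in
/-- The transition probabilities from a point to a uniformly chosen mate. -/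
noncomputable def mateWeight (r : Fin n → Fin n → Prop) (a b : Fin n) : ℝ≥0∞ :=
  if b ∈ mates r a then ((mates r a).card : ℝ≥0∞)⁻¹ else 0

/-- Related points have equally many mates, so the walk to a uniform mate is symmetric. This makes
the weights invariant under exchanges. -/
theorem mateWeight_comm (hs : ∀ a b, r a b → r b a) (ht : ∀ a b c, r a b → r b c → r a c)
    (a b : Fin n) : mateWeight r a b = mateWeight r b a := by
  unfold mateWeight
  by_cases h : b ∈ mates r a
  · rw [if_pos h, if_pos ((mem_mates_comm hs).1 h), card_mates_eq hs ht (mem_mates.1 h).2]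
  · rw [if_neg h, if_neg (mt (mem_mates_comm hs).2 h)]

theorem sum_mateWeight (a : Fin n) :
    ∑ b, mateWeight r a b = ((mates r a).card : ℝ≥0∞) * ((mates r a).card : ℝ≥0∞)⁻¹ := by
  classical
  simp only [mateWeight, Finset.sum_ite_mem, Finset.univ_inter, Finset.sum_const, nsmul_eq_mul]

theorem sum_mateWeight_le_one (a : Fin n) : ∑ b, mateWeight r a b ≤ 1 := by
  rw [sum_mateWeight]
  exact ENNReal.mul_inv_le_one _

theorem sum_mateWeight_eq_one {a : Fin n} (h : (mates r a).Nonempty) :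
    ∑ b, mateWeight r a b = 1 := by
  rw [sum_mateWeight, ENNReal.mul_inv_cancel (by simpa using h.ne_empty)
    (ENNReal.natCast_ne_top _)]

/-- Exchange the target of `i` with `b`. -/
def exchange (i : Fin n) (p : Equiv.Perm (Fin n) × Fin n) : Equiv.Perm (Fin n) × Fin n :=
  (Equiv.swap (p.1 i) p.2 * p.1, p.1 i)

theorem exchange_involutive (i : Fin n) : Function.Involutive (exchange i) := by
  rintro ⟨π, b⟩
  simp only [exchange, Equiv.Perm.mul_apply, Equiv.swap_apply_left, Prod.mk.injEq, and_true]
  rw [Equiv.swap_comm b, Equiv.swap_mul_self_mul]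

open Classical in
/-- If exchanging the target of `i` with a mate always yields a total risk of at least `η`, then
the total risk is at least `η / 2` times the number of permutations for which such an exchange
is possible. -/
theorem mul_card_le_two_mul_sum (hs : ∀ a b, r a b → r b a)
    (ht : ∀ a b c, r a b → r b c → r a c) (i : Fin n) {R : Equiv.Perm (Fin n) → ℝ≥0∞} {η : ℝ≥0∞}
    (hR : ∀ π b, b ≠ π i → r (π i) b → η ≤ R π + R (Equiv.swap (π i) b * π)) :
    ∑ π : Equiv.Perm (Fin n), (if (mates r (π i)).Nonempty then η else 0) ≤ 2 * ∑ π, R π := by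
  have hsum : ∑ p : Equiv.Perm (Fin n) × Fin n, mateWeight r (p.1 i) p.2 * R p.1 ≤ ∑ π, R π := by
    rw [Fintype.sum_prod_type]
    refine Finset.sum_le_sum fun π _ => ?_
    simp only
    rw [← Finset.sum_mul]
    exact mul_le_of_le_one_left zero_le (sum_mateWeight_le_one _)
  -- Reindex by the involution `exchange i`: it reverses the step from `π i` to `b`, and the weight
  -- of a step equals that of its reverse.
  have hswap : ∑ p : Equiv.Perm (Fin n) × Fin n, mateWeight r (p.1 i) p.2 * R p.1
      = ∑ p : Equiv.Perm (Fin n) × Fin n,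
        mateWeight r (p.1 i) p.2 * R (Equiv.swap (p.1 i) p.2 * p.1) := by
    rw [← Equiv.sum_comp (exchange_involutive i).toPerm]
    refine Finset.sum_congr rfl fun p _ => ?_
    simp only [Function.Involutive.coe_toPerm, exchange, Equiv.Perm.mul_apply,
      Equiv.swap_apply_left]
    rw [mateWeight_comm hs ht]
  calc _ ≤ ∑ p : Equiv.Perm (Fin n) × Fin n,
        mateWeight r (p.1 i) p.2 * (R p.1 + R (Equiv.swap (p.1 i) p.2 * p.1)) := by
        rw [Fintype.sum_prod_type]
        refine Finset.sum_le_sum fun π _ => ?_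
        split_ifs with h
        · calc η = ∑ b, mateWeight r (π i) b * η := by
                rw [← Finset.sum_mul, sum_mateWeight_eq_one h, one_mul]
            _ ≤ _ := by
                refine Finset.sum_le_sum fun b _ => ?_
                by_cases hb : b ∈ mates r (π i)
                · exact mul_le_mul_right (hR π b (mem_mates.1 hb).1 (mem_mates.1 hb).2) _
                · simp [mateWeight, hb]
        · exact zero_le
    _ ≤ 2 * ∑ π, R π := by
        simp_rw [mul_add]
        rw [Finset.sum_add_distrib, ← hswap, two_mul]
        exact add_le_add hsum hsum

end Swapping

/-! ### Lower bound: cells of the cube and crowded points. -/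

section Cells

/-- The cell with index `c` in the partition of the cube `[-1,1)^d` into `K ^ d` cubes. -/
def cell {d : ℕ} (K : ℕ) (c : Fin d → Fin K) : Set (Fin d → ℝ) :=
  Set.univ.pi fun k => Set.Ico (-1 + (c k : ℝ) * (2 / K)) (-1 + ((c k : ℝ) + 1) * (2 / K))

theorem measurableSet_cell {d K : ℕ} (c : Fin d → Fin K) : MeasurableSet (cell K c) :=
  MeasurableSet.univ_pi fun _ => measurableSet_Ico

theorem abs_sub_lt_of_mem_cell {d K : ℕ} {c : Fin d → Fin K} {x y : Fin d → ℝ}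
    (hx : x ∈ cell K c) (hy : y ∈ cell K c) (k : Fin d) : |x k - y k| < 2 / K := by
  have h1 := hx k trivial
  have h2 := hy k trivial
  simp only [Set.mem_Ico, add_mul, one_mul] at h1 h2
  exact abs_lt.2 ⟨by linarith, by linarith⟩

theorem eq_of_mem_cell {d K : ℕ} {c c' : Fin d → Fin K} {x : Fin d → ℝ} (h : x ∈ cell K c)
    (h' : x ∈ cell K c') : c = c' := by
  ext k
  have hK : (0 : ℝ) < 2 / K := by
    have : 0 < K := (c k).pos
    positivity
  -- Each coordinate of the index is recovered from the point as a floor.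
  have key : ∀ c : Fin d → Fin K, x ∈ cell K c → ⌊(x k + 1) / (2 / K)⌋₊ = c k := by
    intro c hc
    have := hc k trivial
    simp only [Set.mem_Ico] at this
    have h0 : (0 : ℝ) ≤ (c k : ℕ) := Nat.cast_nonneg _
    have hle : ((c k : ℕ) : ℝ) ≤ (x k + 1) / (2 / K) := by
      rw [le_div_iff₀ hK]; linarith
    rw [Nat.floor_eq_iff (h0.trans hle)]
    exact ⟨hle, by rw [div_lt_iff₀ hK]; linarith⟩
  rw [← key c h, key c' h']

theorem cell_subset {d K : ℕ} (c : Fin d → Fin K) :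
    cell K c ⊆ Set.Icc (fun _ => (-1 : ℝ)) (fun _ => 1) := by
  intro x hx
  rw [Set.mem_Icc, Pi.le_def, Pi.le_def, ← forall_and]
  intro k
  have hK : 0 < K := (c k).pos
  have hK' : (0 : ℝ) < K := by exact_mod_cast hK
  have h := hx k trivial
  simp only [Set.mem_Ico] at h
  have h0 : (0 : ℝ) ≤ (c k : ℕ) * (2 / K) := by positivity
  have h1 : ((c k : ℕ) + 1 : ℝ) * (2 / K) ≤ K * (2 / K) := by
    gcongr
    exact_mod_cast (c k).isLt
  rw [mul_div_cancel₀ _ hK'.ne'] at h1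
  exact ⟨by linarith, by linarith⟩

theorem unifCube_cell {d K : ℕ} (c : Fin d → Fin K) :
    unifCube d (cell K c) = ((K : ℝ≥0∞) ^ d)⁻¹ := by
  rw [unifCube_apply, Set.inter_eq_self_of_subset_right (cell_subset c), cell,
    Real.volume_pi_Ico]
  have h : ∀ k : Fin d, ENNReal.ofReal (-1 + ((c k : ℝ) + 1) * (2 / K) - (-1 + (c k : ℝ) * (2 / K)))
      = 2 * (K : ℝ≥0∞)⁻¹ := by
    intro k
    have hK : (0 : ℝ) < K := by exact_mod_cast (c k).pos
    rw [show -1 + ((c k : ℝ) + 1) * (2 / K) - (-1 + (c k : ℝ) * (2 / K)) = 2 / K by ring,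
      ENNReal.ofReal_div_of_pos hK, ENNReal.ofReal_ofNat, ENNReal.ofReal_natCast,
      div_eq_mul_inv]
  simp_rw [h]
  rw [Finset.prod_const, Finset.card_univ, Fintype.card_fin, mul_pow, ← mul_assoc,
    ENNReal.inv_mul_cancel (by simp) (by simp), one_mul, ENNReal.inv_pow]

/-- Two points lie in a common cell. -/
def SameCell {d : ℕ} (K : ℕ) (x y : Fin d → ℝ) : Prop :=
  ∃ c : Fin d → Fin K, x ∈ cell K c ∧ y ∈ cell K c

theorem SameCell.symm {d K : ℕ} {x y : Fin d → ℝ} : SameCell K x y → SameCell K y x :=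
  fun ⟨c, hx, hy⟩ => ⟨c, hy, hx⟩

theorem SameCell.trans {d K : ℕ} {x y z : Fin d → ℝ} :
    SameCell K x y → SameCell K y z → SameCell K x z := by
  rintro ⟨c, hx, hy⟩ ⟨c', hy', hz⟩
  obtain rfl := eq_of_mem_cell hy hy'
  exact ⟨c, hx, hz⟩

/-- The configurations in which the `a`-th point shares its cell with another one. -/
def crowded (n d K : ℕ) (a : Fin n) : Set (Points n d) :=
  {X | ∃ b, b ≠ a ∧ SameCell K (X a) (X b)}

theorem measurableSet_crowded (n d K : ℕ) (a : Fin n) : MeasurableSet (crowded n d K a) := by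
  have : crowded n d K a = ⋃ b : Fin n, ⋃ _ : b ≠ a, ⋃ c : Fin d → Fin K,
      {X : Points n d | X a ∈ cell K c} ∩ {X : Points n d | X b ∈ cell K c} := by
    ext X
    simp [crowded, SameCell]
  rw [this]
  refine MeasurableSet.iUnion fun b => MeasurableSet.iUnion fun _ => MeasurableSet.iUnion fun c =>
    MeasurableSet.inter ?_ ?_
  · exact (measurable_pi_apply a) (measurableSet_cell c)
  · exact (measurable_pi_apply b) (measurableSet_cell c)

/-- The half-open cells miss the upper faces of the closed cube. Counting `K ^ d` disjoint cells of
mass `1 / K ^ d` shows that nothing of positive mass is lost. -/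
theorem unifCube_iUnion_cell {d K : ℕ} (hK : 0 < K) :
    unifCube d (⋃ c : Fin d → Fin K, cell K c) = 1 := by
  rw [measure_iUnion (fun c c' h => Set.disjoint_left.2 fun x hx hx' => h (eq_of_mem_cell hx hx'))
    measurableSet_cell, tsum_fintype]
  simp_rw [unifCube_cell]
  rw [Finset.sum_const, Finset.card_univ, Fintype.card_fun, Fintype.card_fin, Fintype.card_fin,
    nsmul_eq_mul, Nat.cast_pow]
  exact ENNReal.mul_inv_cancel (pow_ne_zero _ (by exact_mod_cast hK.ne'))
    (ENNReal.pow_ne_top (ENNReal.natCast_ne_top _))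

/-- If `X a` lies in a cell `c` and is alone there, the other `n - 1` points all avoid `c`, which
has probability `p * (1 - p) ^ (n - 1)`. Summing over the cells removes the factor `p`, as `K ^ d *
p = 1`. -/
theorem le_measure_crowded {n d K : ℕ} (hK : 0 < K) (a : Fin n) :
    1 - (1 - ((K : ℝ≥0∞) ^ d)⁻¹) ^ (n - 1)
      ≤ (Measure.pi fun _ => unifCube d) (crowded n d K a) := by
  set μ : Measure (Points n d) := Measure.pi fun _ => unifCube d with hμ
  set p : ℝ≥0∞ := ((K : ℝ≥0∞) ^ d)⁻¹ with hp
  have hsub : (crowded n d K a)ᶜ ⊆ (⋃ c : Fin d → Fin K, Set.univ.pi fun m : Fin n =>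
      if m = a then cell K c else (cell K c)ᶜ) ∪
      Function.eval a ⁻¹' (⋃ c : Fin d → Fin K, cell K c)ᶜ := by
    intro X hX
    by_cases h : X a ∈ ⋃ c : Fin d → Fin K, cell K c
    · left
      obtain ⟨c, hc⟩ := Set.mem_iUnion.1 h
      refine Set.mem_iUnion.2 ⟨c, fun m _ => ?_⟩
      by_cases hm : m = a
      · subst hm; simpa using hc
      · simp only [hm, if_false]
        exact fun hmc => hX ⟨m, hm, c, hc, hmc⟩
    · exact Or.inr h
  have hbox : ∀ c : Fin d → Fin K, μ (Set.univ.pi fun m : Fin n =>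
      if m = a then cell K c else (cell K c)ᶜ) = p * (1 - p) ^ (n - 1) := by
    intro c
    rw [hμ, Measure.pi_pi, ← Finset.mul_prod_erase _ _ (Finset.mem_univ a), if_pos rfl,
      unifCube_cell, Finset.prod_congr rfl fun m hm => by
        rw [if_neg (Finset.ne_of_mem_erase hm),
          prob_compl_eq_one_sub (measurableSet_cell c), unifCube_cell]]
    simp [hp]
  have hnull : μ (Function.eval a ⁻¹' (⋃ c : Fin d → Fin K, cell K c)ᶜ) = 0 := by
    have hm : MeasurableSet (⋃ c : Fin d → Fin K, cell K c) :=
      MeasurableSet.iUnion fun c => measurableSet_cell c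
    rw [hμ, (measurePreserving_eval (fun _ : Fin n => unifCube d) a).measure_preimage
      hm.compl.nullMeasurableSet, prob_compl_eq_one_sub hm, unifCube_iUnion_cell hK, tsub_self]
  have hcompl : μ (crowded n d K a)ᶜ ≤ (1 - p) ^ (n - 1) := by
    refine (measure_mono hsub).trans ((measure_union_le _ _).trans ?_)
    rw [hnull, add_zero]
    refine (measure_iUnion_le _).trans ?_
    rw [tsum_fintype]
    simp_rw [hbox]
    rw [Finset.sum_const, Finset.card_univ, Fintype.card_fun, Fintype.card_fin, Fintype.card_fin,
      nsmul_eq_mul, Nat.cast_pow, ← mul_assoc, hp, ENNReal.mul_inv_cancel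
        (pow_ne_zero _ (by exact_mod_cast hK.ne'))
        (ENNReal.pow_ne_top (ENNReal.natCast_ne_top _)), one_mul]
  rw [prob_compl_eq_one_sub (measurableSet_crowded n d K a)] at hcompl
  exact tsub_le_iff_tsub_le.1 hcompl

end Cells

/-! ### Lower bound: the risk of an arbitrary estimator. -/

section LowerBound

variable {n d : ℕ}

/-- The observations from which the estimator does not recover `a` as the `i`-th target. -/
def missSet (f : Estimator n d) (X : Points n d) (i a : Fin n) : Set (Points n d) :=
  {Y | f.1 (X, Y) i ≠ a}

theorem measurableSet_missSet (f : Estimator n d) (X : Points n d) (i a : Fin n) :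
    MeasurableSet (missSet f X i a) :=
  (f.2.comp (measurable_prodMk_left (x := X)))
    (MeasurableSet.of_discrete (s := {π : Equiv.Perm (Fin n) | π i ≠ a}))

open Classical in
theorem measurable_miss (f : Estimator n d) (σ : ℝ) (π : Equiv.Perm (Fin n)) (i : Fin n) :
    Measurable fun p : Points n d × Points n d =>
      (missSet f p.1 i (π i)).indicator (1 : Points n d → ℝ≥0∞) (observed σ p.1 p.2 π) := by
  have h : Measurable fun p : Points n d × Points n d => f.1 (p.1, observed σ p.1 p.2 π) :=
    f.2.comp (measurable_fst.prodMk ((measurable_observed σ).comp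
      (measurable_id.prodMk measurable_const)))
  convert (Measurable.of_discrete (f := fun τ : Equiv.Perm (Fin n) =>
    if τ i ≠ π i then (1 : ℝ≥0∞) else 0)).comp h using 2 with p
  by_cases hp : f.1 (p.1, observed σ p.1 p.2 π) i = π i <;> simp [missSet, Set.indicator, hp]

theorem hammingDist_eq_sum_miss (f : Estimator n d) (σ : ℝ) (X Z : Points n d)
    (π : Equiv.Perm (Fin n)) :
    (hammingDist (f.1 (X, observed σ X Z π) : Fin n → Fin n) (π : Fin n → Fin n) : ℝ≥0∞)
      = ∑ i, (missSet f X i (π i)).indicator (1 : Points n d → ℝ≥0∞) (observed σ X Z π) := by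
  classical
  rw [hammingDist, Finset.card_filter, Nat.cast_sum]
  refine Finset.sum_congr rfl fun i _ => ?_
  by_cases h : f.1 (X, observed σ X Z π) i = π i <;> simp [missSet, Set.indicator, h]

theorem lintegral_miss (Q : Measure ℝ) [IsProbabilityMeasure Q] (f : Estimator n d) (σ : ℝ)
    (X : Points n d) (π : Equiv.Perm (Fin n)) (i : Fin n) :
    ∫⁻ Z, (missSet f X i (π i)).indicator (1 : Points n d → ℝ≥0∞) (observed σ X Z π)
      ∂(Measure.pi fun _ => Measure.pi fun _ => Q)
      = observationLaw Q σ (fun m => X (π m)) (missSet f X i (π i)) := by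
  have hobs : Measurable fun Z : Points n d => observed σ X Z π :=
    (measurable_observed σ).comp ((measurable_const.prodMk measurable_id).prodMk measurable_const)
  have hm := measurableSet_missSet f X i (π i)
  rw [← map_observed, ← lintegral_map (measurable_one.indicator hm) hobs,
    lintegral_indicator_one hm]

/-- The exchange alters only the rows `i` and `π.symm b`, each within one cell. An estimate that is
correct at `i` for `π` is wrong there for the exchanged permutation, so the two miss probabilities
dominate the errors of a single test. -/
theorem le_miss_add_miss_swap {Q : Measure ℝ} [IsProbabilityMeasure Q] {δ : ℝ}
    (hTV : (⨆ v : {v : ℝ // |v| < 1}, tvDist (translate Q v.1) Q) < 1 - δ) {σ : ℝ} (hσ : 0 < σ)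
    {K : ℕ} (hKσ : 2 / K ≤ σ) (f : Estimator n d) (X : Points n d) (i : Fin n)
    (π : Equiv.Perm (Fin n)) (b : Fin n) (hb : b ≠ π i) (h : SameCell K (X (π i)) (X b)) :
    ENNReal.ofReal δ ^ (2 * d) ≤
      observationLaw Q σ (fun m => X (π m)) (missSet f X i (π i)) +
      observationLaw Q σ (fun m => X ((Equiv.swap (π i) b * π) m))
        (missSet f X i ((Equiv.swap (π i) b * π) i)) := by
  obtain ⟨c, hc, hc'⟩ := h
  have hij : i ≠ π.symm b := fun h => hb (by rw [h, Equiv.apply_symm_apply])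
  refine (le_observationLaw_add_compl hTV hσ (X := fun m => X (π m))
    (X' := fun m => X ((Equiv.swap (π i) b * π) m)) hij ?_ ?_ ?_
    (missSet f X i (π i))).trans ?_
  · intro m hmi hmj
    rw [Equiv.Perm.mul_apply, Equiv.swap_apply_of_ne_of_ne (fun h => hmi (π.injective h))
      (fun h => hmj (by rw [← h, Equiv.symm_apply_apply]))]
  · intro k
    simp only [Equiv.Perm.mul_apply, Equiv.swap_apply_left]
    exact (abs_sub_lt_of_mem_cell hc hc' k).trans_le hKσ
  · intro k
    simp only [Equiv.Perm.mul_apply, Equiv.apply_symm_apply, Equiv.swap_apply_right]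
    exact (abs_sub_lt_of_mem_cell hc' hc k).trans_le hKσ
  · gcongr
    intro Y hY
    simp only [missSet, Set.mem_compl_iff, Set.mem_ofPred_eq, not_not] at hY ⊢
    rw [hY, Equiv.Perm.mul_apply, Equiv.swap_apply_left]
    exact hb.symm

/-- For fixed points, sharing a cell is symmetric and transitive, so the exchange inequality
applies; a mate exists exactly when the point is crowded. Integrating over the points brings in the
crowding probability. -/
theorem le_sum_lintegral_miss {Q : Measure ℝ} [IsProbabilityMeasure Q] {δ : ℝ}
    (hTV : (⨆ v : {v : ℝ // |v| < 1}, tvDist (translate Q v.1) Q) < 1 - δ) {σ : ℝ} (hσ : 0 < σ)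
    {K : ℕ} (hK : 0 < K) (hKσ : 2 / K ≤ σ) (f : Estimator n d) (i : Fin n) :
    (n.factorial : ℝ≥0∞) *
      (ENNReal.ofReal δ ^ (2 * d) * (1 - (1 - ((K : ℝ≥0∞) ^ d)⁻¹) ^ (n - 1))) ≤
    2 * ∑ π : Equiv.Perm (Fin n), ∫⁻ X : Points n d, ∫⁻ Z,
      (missSet f X i (π i)).indicator (1 : Points n d → ℝ≥0∞) (observed σ X Z π)
        ∂(Measure.pi fun _ => Measure.pi fun _ => Q) ∂(Measure.pi fun _ => unifCube d) := by
  classical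
  set η := ENNReal.ofReal δ ^ (2 * d)
  calc _ ≤ ∑ π : Equiv.Perm (Fin n),
        η * (Measure.pi fun _ => unifCube d) (crowded n d K (π i)) := by
        refine le_trans ?_ (Finset.sum_le_sum fun π _ =>
          mul_le_mul_right (le_measure_crowded hK (π i)) η)
        rw [Finset.sum_const, Finset.card_univ, Fintype.card_perm, Fintype.card_fin,
          nsmul_eq_mul]
    _ = ∫⁻ X : Points n d, ∑ π : Equiv.Perm (Fin n),
        (crowded n d K (π i)).indicator (fun _ => η) X ∂(Measure.pi fun _ => unifCube d) := by
        rw [lintegral_finsetSum _ fun π _ =>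
          measurable_const.indicator (measurableSet_crowded n d K (π i))]
        refine Finset.sum_congr rfl fun π _ => ?_
        rw [lintegral_indicator_const (measurableSet_crowded n d K (π i))]
    _ ≤ ∫⁻ X : Points n d, 2 * ∑ π : Equiv.Perm (Fin n),
        observationLaw Q σ (fun m => X (π m)) (missSet f X i (π i))
          ∂(Measure.pi fun _ => unifCube d) := by
        refine lintegral_mono fun X => ?_
        refine le_trans (le_of_eq ?_) (mul_card_le_two_mul_sum
          (r := fun a b => SameCell K (X a) (X b)) (fun _ _ => SameCell.symm)
          (fun _ _ _ => SameCell.trans) i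
          (R := fun π => observationLaw Q σ (fun m => X (π m)) (missSet f X i (π i)))
          (fun π b hb h => le_miss_add_miss_swap hTV hσ hKσ f X i π b hb h))
        refine Finset.sum_congr rfl fun π _ => ?_
        have hiff : X ∈ crowded n d K (π i) ↔
            (mates (fun a b => SameCell K (X a) (X b)) (π i)).Nonempty := by
          simp [crowded, Finset.Nonempty, mem_mates]
        by_cases h : X ∈ crowded n d K (π i)
        · rw [Set.indicator_of_mem h, if_pos (hiff.1 h)]
        · rw [Set.indicator_of_notMem h, if_neg (mt hiff.2 h)]
    _ = _ := by
        rw [lintegral_const_mul' _ _ (by simp)]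
        congr 1
        simp_rw [← lintegral_miss]
        rw [lintegral_finsetSum _ fun π _ => (measurable_miss f σ π i).lintegral_prod_right']

theorem le_two_mul_expectedMistakes {Q : Measure ℝ} [IsProbabilityMeasure Q] {δ : ℝ}
    (hTV : (⨆ v : {v : ℝ // |v| < 1}, tvDist (translate Q v.1) Q) < 1 - δ) {σ : ℝ} (hσ : 0 < σ)
    {K : ℕ} (hK : 0 < K) (hKσ : 2 / K ≤ σ) (f : Estimator n d) :
    n * (ENNReal.ofReal δ ^ (2 * d) * (1 - (1 - ((K : ℝ≥0∞) ^ d)⁻¹) ^ (n - 1))) ≤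
      2 * ENNReal.ofReal (expectedMistakes (unifCube d) (Measure.pi fun _ => Q) σ f) := by
  have hmiss := le_sum_lintegral_miss hTV hσ hK hKσ f
  generalize ENNReal.ofReal δ ^ (2 * d) * (1 - (1 - ((K : ℝ≥0∞) ^ d)⁻¹) ^ (n - 1)) = q at hmiss ⊢
  have hn : (n.factorial : ℝ≥0∞)⁻¹ * n.factorial = 1 :=
    ENNReal.inv_mul_cancel (by exact_mod_cast n.factorial_ne_zero) (ENNReal.natCast_ne_top _)
  rw [ofReal_expectedMistakes, lintegral_modelLaw _ _
    (measurable_natCast_hammingDist_estimator σ f)]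
  simp_rw [hammingDist_eq_sum_miss]
  have hsum : ∀ π : Equiv.Perm (Fin n), ∫⁻ X : Points n d, ∫⁻ Z,
      ∑ i, (missSet f X i (π i)).indicator (1 : Points n d → ℝ≥0∞) (observed σ X Z π)
        ∂(Measure.pi fun _ => Measure.pi fun _ => Q) ∂(Measure.pi fun _ => unifCube d)
      = ∑ i, ∫⁻ X : Points n d, ∫⁻ Z,
      (missSet f X i (π i)).indicator (1 : Points n d → ℝ≥0∞) (observed σ X Z π)
        ∂(Measure.pi fun _ => Measure.pi fun _ => Q) ∂(Measure.pi fun _ => unifCube d) :=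
    fun π => lintegral_lintegral_finset_sum _ fun i _ => measurable_miss f σ π i
  simp_rw [hsum]
  rw [Finset.sum_comm, mul_left_comm, Finset.mul_sum]
  calc (n : ℝ≥0∞) * q = (n.factorial : ℝ≥0∞)⁻¹ * ∑ _i : Fin n, (n.factorial : ℝ≥0∞) * q := by
        rw [Finset.sum_const, Finset.card_univ, Fintype.card_fin, nsmul_eq_mul,
          mul_left_comm (n : ℝ≥0∞), ← mul_assoc, hn, one_mul]
    _ ≤ _ := mul_le_mul_right (Finset.sum_le_sum fun i _ => hmiss i) _

theorem le_two_mul_minimaxMistakes {Q : Measure ℝ} [IsProbabilityMeasure Q] {δ : ℝ}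
    (hδ : 0 ≤ δ) (hTV : (⨆ v : {v : ℝ // |v| < 1}, tvDist (translate Q v.1) Q) < 1 - δ) {σ : ℝ}
    (hσ : 0 < σ) {K : ℕ} (hK : 0 < K) (hKσ : 2 / K ≤ σ) :
    n * (δ ^ (2 * d) * (1 - (1 - ((K : ℝ) ^ d)⁻¹) ^ (n - 1))) ≤
      2 * minimaxMistakes n d (unifCube d) (Measure.pi fun _ => Q) σ := by
  rw [← div_le_iff₀' two_pos]
  refine le_ciInf fun f => ?_
  rw [div_le_iff₀' two_pos]
  have hnn := expectedMistakes_nonneg (unifCube d) (Measure.pi fun _ => Q) σ f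
  refine (ENNReal.ofReal_le_ofReal_iff (by positivity)).1 ?_
  have hK1 : (1 : ℝ) ≤ (K : ℝ) ^ d := one_le_pow₀ (by exact_mod_cast hK)
  have hp : ENNReal.ofReal ((K : ℝ) ^ d)⁻¹ = ((K : ℝ≥0∞) ^ d)⁻¹ := by
    rw [ENNReal.ofReal_inv_of_pos (by positivity), ENNReal.ofReal_pow (by positivity),
      ENNReal.ofReal_natCast]
  have hp1 : 0 ≤ 1 - ((K : ℝ) ^ d)⁻¹ := sub_nonneg.2 (inv_le_one_of_one_le₀ hK1)
  rw [ENNReal.ofReal_mul (by positivity), ENNReal.ofReal_mul (by positivity),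
    ENNReal.ofReal_mul (by positivity), ENNReal.ofReal_natCast, ENNReal.ofReal_pow hδ,
    ENNReal.ofReal_sub _ (by positivity), ENNReal.ofReal_pow hp1,
    ENNReal.ofReal_sub _ (by positivity), hp, ENNReal.ofReal_one, ENNReal.ofReal_ofNat]
  exact le_two_mul_expectedMistakes hTV hσ hK hKσ f

end LowerBound

end GeoMatch

/-! ### Matching the two bounds and extracting the exponent. -/

namespace GeoMatch

/-- With `t = m * p`, the power is at most `exp (-t) ≤ 1 / (1 + t)`, and `t / (1 + t)` is at least
half of `min 1 t`. -/
theorem min_one_mul_div_two_le {p : ℝ} (hp : 0 ≤ p) (hp1 : p ≤ 1) (m : ℕ) :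
    min 1 (m * p) / 2 ≤ 1 - (1 - p) ^ m := by
  set t := m * p with ht
  have ht0 : 0 ≤ t := by positivity
  have h1 : (1 - p) ^ m ≤ (1 + t)⁻¹ := by
    calc (1 - p) ^ m ≤ Real.exp (-p) ^ m :=
          pow_le_pow_left₀ (sub_nonneg.2 hp1) (Real.one_sub_le_exp_neg p) m
      _ = (Real.exp t)⁻¹ := by rw [← Real.exp_nat_mul, ← Real.exp_neg, ht, mul_neg]
      _ ≤ (1 + t)⁻¹ := by
          gcongr
          linarith [Real.add_one_le_exp t]
  refine le_trans ?_ (sub_le_sub_left h1 1)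
  have h2 : 1 - (1 + t)⁻¹ = t / (1 + t) := by field_simp; ring
  rw [h2, div_le_div_iff₀ two_pos (by positivity)]
  rcases le_total 1 t with h | h
  · rw [min_eq_left h]; linarith
  · rw [min_eq_right h]; nlinarith

theorem mul_min_le_minimaxMistakes {Q : Measure ℝ} [IsProbabilityMeasure Q] {δ : ℝ} (hδ : 0 ≤ δ)
    (hTV : (⨆ v : {v : ℝ // |v| < 1}, tvDist (translate Q v.1) Q) < 1 - δ) {σ : ℝ} (hσ : 0 < σ)
    {n : ℕ} (hn : 2 ≤ n) (d : ℕ) :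
    1 / 8 * (δ ^ 2 / 3) ^ d * min ((n : ℝ) ^ 2 * σ ^ d) n ≤
      minimaxMistakes n d (unifCube d) (Measure.pi fun _ => Q) σ := by
  -- The smallest `K` for which the cells have side at most `σ`.
  set K := ⌈2 / σ⌉₊ with hKdef
  have hK : 0 < K := Nat.ceil_pos.2 (by positivity)
  have hK' : (0 : ℝ) < K := by exact_mod_cast hK
  have hKσ : 2 / (K : ℝ) ≤ σ := by
    rw [div_le_comm₀ hK' hσ]; exact Nat.le_ceil _
  have hn' : (2 : ℝ) ≤ n := by exact_mod_cast hn
  have hmain := le_two_mul_minimaxMistakes (n := n) (d := d) hδ hTV hσ hK hKσ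
  -- For large `σ` the ceiling stays at `1` while `2 / σ` tends to `0`; truncating at `1` gives `K ≤
  -- 3 / τ` for every `σ`, at the cost of a factor `3 ^ d`.
  set τ := min σ 1
  have hτ : 0 < τ := lt_min hσ one_pos
  have hKτ : (K : ℝ) ≤ 3 / τ := by
    have h1 : (K : ℝ) < 2 / σ + 1 := Nat.ceil_lt_add_one (by positivity)
    have h2 : 2 / σ ≤ 2 / τ := by gcongr; exact min_le_left _ _
    have h3 : 1 ≤ 1 / τ := by rw [le_div_iff₀ hτ, one_mul]; exact min_le_right _ _
    have h4 : 3 / τ = 2 / τ + 1 / τ := by ring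
    linarith
  set p := ((K : ℝ) ^ d)⁻¹
  have hp : (τ / 3) ^ d ≤ p := by
    rw [show (τ / 3) ^ d = ((3 / τ) ^ d)⁻¹ by rw [← inv_pow, inv_div]]
    exact inv_anti₀ (by positivity) (pow_le_pow_left₀ hK'.le hKτ d)
  have hp0 : 0 ≤ p := by positivity
  have hp1 : p ≤ 1 := inv_le_one_of_one_le₀ (one_le_pow₀ (by exact_mod_cast hK))
  have hq := min_one_mul_div_two_le hp0 hp1 (n - 1)
  rw [Nat.cast_sub (by omega), Nat.cast_one] at hq
  have h3 : (1 / 3 : ℝ) ^ d ≤ 1 := pow_le_one₀ (by norm_num) (by norm_num)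
  have hmin : 1 / 2 * (1 / 3) ^ d * min 1 (n * τ ^ d) ≤ min 1 (((n : ℝ) - 1) * p) := by
    have hm0 : 0 ≤ min 1 (n * τ ^ d) := by positivity
    refine le_min ?_ ?_
    · have := min_le_left 1 (n * τ ^ d)
      have h5 : (1 / 3 : ℝ) ^ d * min 1 (n * τ ^ d) ≤ 1 := mul_le_one₀ h3 hm0 this
      nlinarith
    · calc 1 / 2 * (1 / 3) ^ d * min 1 (n * τ ^ d) ≤ 1 / 2 * (1 / 3) ^ d * (n * τ ^ d) := by
            gcongr; exact min_le_right _ _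
        _ = (n / 2) * (τ / 3) ^ d := by rw [div_pow, div_pow, one_pow]; ring
        _ ≤ (n - 1) * p := by
            gcongr
            · linarith
            · linarith
  have hscale : min ((n : ℝ) ^ 2 * σ ^ d) n ≤ n * min 1 (n * τ ^ d) := by
    rcases le_total σ 1 with h | h
    · have : τ = σ := min_eq_left h
      rw [this, mul_min_of_nonneg _ _ (by positivity), mul_one, min_comm]
      apply le_of_eq; ring_nf
    · have : τ = 1 := min_eq_right h
      rw [this, one_pow, mul_one, min_eq_left (by linarith : (1 : ℝ) ≤ n), mul_one]
      exact min_le_right _ _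
  -- The constant `1 / 8` collects three halves: from `n - 1 ≥ n / 2`, from
  -- `min_one_mul_div_two_le`, and from the exchange argument.
  calc 1 / 8 * (δ ^ 2 / 3) ^ d * min ((n : ℝ) ^ 2 * σ ^ d) n
      ≤ 1 / 8 * (δ ^ 2 / 3) ^ d * (n * min 1 (n * τ ^ d)) := by gcongr
    _ = n * (δ ^ (2 * d) * ((1 / 2 * (1 / 3) ^ d * min 1 (n * τ ^ d)) / 2)) / 2 := by
        rw [div_pow, div_pow, one_pow, pow_mul]; ring
    _ ≤ n * (δ ^ (2 * d) * (min 1 (((n : ℝ) - 1) * p) / 2)) / 2 := by gcongr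
    _ ≤ n * (δ ^ (2 * d) * (1 - (1 - p) ^ (n - 1))) / 2 := by gcongr
    _ ≤ _ := by linarith

theorem minimaxMistakes_le_mul_min {Q : Measure ℝ} [IsProbabilityMeasure Q] {L : ℝ} (hL0 : 0 < L)
    (hL : ∫⁻ u, ENNReal.ofReal (Real.exp (u ^ 2 / L ^ 2)) ∂Q ≤ 2) {σ : ℝ} (hσ : 0 < σ)
    (n d : ℕ) :
    minimaxMistakes n d (unifCube d) (Measure.pi fun _ => Q) σ
      ≤ 2 * (max 1 (L * √Real.pi)) ^ d * min ((n : ℝ) ^ 2 * σ ^ d) n := by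
  rw [mul_min_of_nonneg _ _ (by positivity)]
  refine le_min ((minimaxMistakes_le hL0 hL hσ n d).trans ?_)
    ((minimaxMistakes_le_card _ _ σ).trans ?_)
  · calc 2 * (n : ℝ) ^ 2 * (σ * L * √Real.pi) ^ d
        = 2 * (L * √Real.pi) ^ d * (n ^ 2 * σ ^ d) := by
          rw [mul_assoc σ, mul_pow σ]; ring
      _ ≤ _ := by gcongr; exact le_max_right _ _
  · have h1 : (1 : ℝ) ≤ (max 1 (L * √Real.pi)) ^ d := one_le_pow₀ (le_max_left _ _)
    refine le_mul_of_one_le_left (Nat.cast_nonneg n) (by linarith)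

/-- Two-sided bounds up to factors exponential in `d n = o(log n)` determine a sequence up to a
factor `n ^ o(1)`. -/
theorem exists_exponent_of_bounds {d : ℕ → ℕ}
    (hd : (fun n => (d n : ℝ)) =o[atTop] (fun n => Real.log (n : ℝ))) {M m : ℕ → ℝ}
    {c₁ c₂ A B : ℝ} (hc₁ : 0 < c₁) (hc₂ : 0 < c₂) (hA : 0 < A) (hB : 0 < B)
    (hm : ∀ n, 2 ≤ n → 0 < m n) (hlow : ∀ n, 2 ≤ n → c₁ * A ^ d n * m n ≤ M n)
    (hup : ∀ n, 2 ≤ n → M n ≤ c₂ * B ^ d n * m n) :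
    ∃ a : ℕ → ℝ, Tendsto a atTop (𝓝 0) ∧ ∀ n, 2 ≤ n → M n = (n : ℝ) ^ a n * m n := by
  have hlog : Tendsto (fun n : ℕ => Real.log (n : ℝ)) atTop atTop :=
    Real.tendsto_log_atTop.comp tendsto_natCast_atTop_atTop
  have hlim : ∀ c C : ℝ, Tendsto (fun n : ℕ => (c + d n * C) / Real.log n) atTop (𝓝 0) := by
    intro c C
    have h1 := (hlog.const_div_atTop c).add (hd.tendsto_div_nhds_zero.mul_const C)
    rw [zero_mul, add_zero] at h1
    refine h1.congr fun n => ?_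
    ring
  have hlogform : ∀ {c C : ℝ} (k : ℕ), 0 < c → 0 < C →
      Real.log (c * C ^ k) = Real.log c + k * Real.log C := by
    intro c C k hc hC
    rw [Real.log_mul hc.ne' (pow_ne_zero _ hC.ne'), Real.log_pow]
  have hM : ∀ n, 2 ≤ n → 0 < M n := fun n hn =>
    lt_of_lt_of_le (mul_pos (by positivity) (hm n hn)) (hlow n hn)
  have hpos : ∀ n : ℕ, 2 ≤ n → 0 < Real.log n := fun n hn =>
    Real.log_pos (by exact_mod_cast hn)
  -- This exponent is forced by the equation. Its numerator lies between two affine functions of `d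
  -- n`, which are negligible against `log n`.
  refine ⟨fun n => Real.log (M n / m n) / Real.log n, ?_, fun n hn => ?_⟩
  · refine tendsto_of_tendsto_of_tendsto_of_le_of_le' (hlim (Real.log c₁) (Real.log A))
      (hlim (Real.log c₂) (Real.log B)) ?_ ?_
    · filter_upwards [eventually_ge_atTop 2] with n hn
      refine div_le_div_of_nonneg_right ?_ (hpos n hn).le
      rw [← hlogform _ hc₁ hA]
      exact Real.log_le_log (by positivity) ((le_div_iff₀ (hm n hn)).2 (hlow n hn))
    · filter_upwards [eventually_ge_atTop 2] with n hn
      refine div_le_div_of_nonneg_right ?_ (hpos n hn).le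
      rw [← hlogform _ hc₂ hB]
      exact Real.log_le_log (div_pos (hM n hn) (hm n hn))
        ((div_le_iff₀ (hm n hn)).2 (hup n hn))
  · have hn0 : (0 : ℝ) < n := by positivity
    rw [Real.rpow_def_of_pos hn0, mul_div_cancel₀ _ (hpos n hn).ne',
      Real.exp_log (div_pos (hM n hn) (hm n hn)), div_mul_cancel₀ _ (hm n hn).ne']

theorem exists_of_subGaussianNorm_lt_top {Q : Measure ℝ} (h : subGaussianNorm Q < ∞) :
    ∃ L : ℝ, 0 < L ∧ ∫⁻ u, ENNReal.ofReal (Real.exp (u ^ 2 / L ^ 2)) ∂Q ≤ 2 := by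
  unfold subGaussianNorm at h
  simp only [iInf_lt_iff] at h
  obtain ⟨L, ⟨h0, hL⟩, _⟩ := h
  exact ⟨L, by exact_mod_cast h0, hL⟩

end GeoMatch

theorem proposition2p4
    (Q' : Measure ℝ) [IsProbabilityMeasure Q']
    (hmean : (∫ x, x ∂Q') = 0)
    (hsub : GeoMatch.subGaussianNorm Q' < ∞)
    (δ : ℝ) (hδ : δ ∈ Set.Ioo (0 : ℝ) 1)
    (hTV : (⨆ v : {v : ℝ // |v| < 1}, GeoMatch.tvDist (GeoMatch.translate Q' v.1) Q') < 1 - δ)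
    (d : ℕ → ℕ) (hd_pos : ∀ n, 1 ≤ d n)
    (hd : (fun n => (d n : ℝ)) =o[atTop] (fun n => Real.log (n : ℝ)))
    (σ : ℕ → ℝ) (hσ : ∀ n, 0 < σ n) :
    ∃ a b : ℕ → ℝ, Tendsto a atTop (𝓝 0) ∧ Tendsto b atTop (𝓝 0) ∧
      ∀ᶠ n : ℕ in atTop,
        GeoMatch.minimaxMistakes n (d n) (GeoMatch.unifCube (d n)) (Measure.pi fun _ => Q') (σ n) =
          min ((n : ℝ) ^ (2 + a n) * σ n ^ d n) ((n : ℝ) ^ (1 + b n)) := by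
  obtain ⟨L, hL0, hL⟩ := GeoMatch.exists_of_subGaussianNorm_lt_top hsub
  have hδ0 := hδ.1
  obtain ⟨a, ha, hM⟩ := GeoMatch.exists_exponent_of_bounds hd
    (M := fun n => GeoMatch.minimaxMistakes n (d n) (GeoMatch.unifCube (d n))
      (Measure.pi fun _ => Q') (σ n))
    (m := fun n => min ((n : ℝ) ^ 2 * σ n ^ d n) n) (c₁ := 1 / 8) (c₂ := 2) (A := δ ^ 2 / 3)
    (B := max 1 (L * √Real.pi)) (by norm_num) two_pos (by positivity) (by positivity)
    (fun n hn => by have := hσ n; positivity)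
    (fun n hn => GeoMatch.mul_min_le_minimaxMistakes hδ0.le hTV (hσ n) hn (d n))
    (fun n _ => GeoMatch.minimaxMistakes_le_mul_min hL0 hL (hσ n) n (d n))
  -- The common factor `n ^ a n` multiplies both terms of the minimum, so one sequence serves for
  -- both exponents.
  refine ⟨a, a, ha, ha, ?_⟩
  filter_upwards [eventually_ge_atTop 2] with n hn
  have hn0 : (0 : ℝ) < n := by positivity
  rw [hM n hn, mul_min_of_nonneg _ _ (by positivity), Real.rpow_add hn0, Real.rpow_add hn0,
    Real.rpow_one, Real.rpow_two]
  congr 1 <;> ring
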